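/- Let $d\ge 2$, let $Y_d=\mathbb{R}^d/\mathbb{Z}^d$ be the torus, and let $dx$ be Lebesgue measure on $Y_d$ (identified with the unit cube). Let $\rho_S:\mathbb{R}^d\to[0,\infty)$ be a $\mathbb{Z}^d$-periodic function of class $C^1$ whose zero set in $Y_d$ is finite and non-empty, and such that $\sigma_S:=1/\rho_S$ is integrable on $Y_d$; write $\overline{\sigma_S}:=\int_{Y_d}\sigma_S(x)\,dx$. Let $\xi\in\mathbb{R}^d$ have incommensurable coordinates, i.e. $k\cdot\xi\neq 0$ for every $k\in\mathbb{Z}^d\setminus\{0\}$. Put $b_S:=\rho_S\,\xi$, and let $S$ be the flow of $b_S$ (the Stepanoff flow), that is $\partial_t S(t,x)=b_S(S(t,x))$ for $t\in\mathbb{R}$ and $S(0,x)=x$, regarded as a flow on $Y_d$. Let $\mathscr{I}_{b_S}$ be the set of Borel probability measures $\mu$ on $Y_d$ that are invariant for $S$, i.e. $\int_{Y_d}\psi(S(t,y))\,d\mu(y)=\int_{Y_d}\psi(y)\,d\mu(y)$ for all $t\in\mathbb{R}$ and all continuous $\psi:Y_d\to\mathbb{R}$. The flow $S$ is called ergodic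 with respect to $\mu\in\mathscr{I}_{b_S}$ if every $f\in L^1(Y_d,\mu)$ such that, for each $t\in\mathbb{R}$, $f(S(t,\cdot))=f$ $\mu$-a.e., is $\mu$-a.e. equal to the constant $\int_{Y_d}f\,d\mu$. Define $$\mathsf{C}_{b_S}:=\Big\{\int_{Y_d}b_S\,d\mu:\ \mu\in\mathscr{I}_{b_S}\Big\},\qquad \mathsf{D}_{b_S}:=\Big\{\int_{Y_d}b_S(y)\,\sigma(y)\,dy:\ \sigma\in L^1(Y_d),\ \sigma(y)\,dy\in\mathscr{I}_{b_S}\Big\}.$$ Then $0<\overline{\sigma_S}<\infty$, and: 1. the measure $\frac{\sigma_S(x)}{\overline{\sigma_S}}\,dx$ is the unique measure in $\mathscr{I}_{b_S}$ that does not charge the zero set of $\rho_S$; 2. the flow $S$ is ergodic with respect to $\frac{\sigma_S(x)}{\overline{\sigma_S}}\,dx$; 3. with $\zeta:=\frac{1}{\overline{\sigma_S}}\,\xi$ one has $\mathsf{D}_{b_S}=\{\zeta\}$ and $\mathsf{C}_{b_S}=[0,\zeta]$ (the segment in $\mathbb{R}^d$ with endpoints $0$ and $\zeta$). -/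

import Mathlib

open MeasureTheory Set Topology

namespace TorusFlow

/-- `ℝ^d` with its Euclidean norm. -/
abbrev Space (d : ℕ) := EuclideanSpace ℝ (Fin d)

/-- The torus `Y_d = ℝ^d / ℤ^d`. Functions on it are the `ℤ^d`-periodic functions on `ℝ^d`, and its
`volume` is Lebesgue measure on the unit cube. -/
abbrev Torus (d : ℕ) := UnitAddTorus (Fin d)

/-- The canonical projection `ℝ^d → ℝ^d / ℤ^d`. -/
def proj {d : ℕ} (x : Space d) : Torus d := fun i => ((x i : ℝ) : UnitAddCircle)

/-- The representative of a point of the torus in the unit cube `[0,1)^d`. -/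
noncomputable def rep {d : ℕ} (y : Torus d) : Space d :=
  WithLp.toLp 2 fun i => (AddCircle.equivIco (1 : ℝ) 0 (y i) : ℝ)

theorem proj_rep {d : ℕ} (y : Torus d) : proj (rep y) = y := by
  funext i
  exact (AddCircle.equivIco (1 : ℝ) 0).symm_apply_apply (y i)

/-- `f` is of class `C^1` on the torus, that is, its `ℤ^d`-periodic version on `ℝ^d` is `C^1`. -/
def IsC1 {d : ℕ} {F : Type*} [NormedAddCommGroup F] [NormedSpace ℝ F] (f : Torus d → F) : Prop :=
  ContDiff ℝ 1 fun x : Space d => f (proj x)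

/-- `X` is the flow on `ℝ^d` of the (periodic) vector field `b`:
`∂X/∂t (t,x) = b (X(t,x))` for all `t ∈ ℝ`, and `X(0,x) = x`. -/
def IsFlow {d : ℕ} (b : Torus d → Space d) (X : ℝ → Space d → Space d) : Prop :=
  ∀ x, X 0 x = x ∧ ∀ t, HasDerivAt (fun s => X s x) (b (proj (X t x))) t

theorem proj_eq_iff {d : ℕ} {x x' : Space d} :
    proj x = proj x' ↔ ∃ k : Fin d → ℤ, x' = x + WithLp.toLp 2 fun i => (k i : ℝ) := by
  constructor
  · intro h
    have h1 : ∀ i, ∃ k : ℤ, x' i = x i + k := by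
      intro i
      obtain ⟨k, hk⟩ := AddSubgroup.mem_zmultiples_iff.1 (QuotientAddGroup.eq.1 (congrFun h i))
      refine ⟨k, ?_⟩
      rw [zsmul_eq_mul, mul_one] at hk
      rw [hk]
      ring
    choose k hk using h1
    exact ⟨k, by ext i; simpa using hk i⟩
  · rintro ⟨k, rfl⟩
    funext i
    simp [proj]

/-- A continuous periodic function is bounded. -/
theorem exists_bound {d : ℕ} {F : Type*} [NormedAddCommGroup F] {w : Space d → F}
    (hw : Continuous w) (hper : ∀ x x', proj x = proj x' → w x = w x') :
    ∃ C : NNReal, ∀ x, ‖w x‖ ≤ C := by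
  obtain ⟨C, hC⟩ := (isCompact_closedBall (0 : Space d) (Real.sqrt d)).exists_bound_of_continuousOn
    hw.continuousOn
  refine ⟨C.toNNReal, fun x => ?_⟩
  rw [hper x (rep (proj x)) (proj_rep _).symm]
  refine (hC _ ?_).trans (Real.le_coe_toNNReal C)
  rw [mem_closedBall_zero_iff, EuclideanSpace.norm_eq]
  apply Real.sqrt_le_sqrt
  calc ∑ i, ‖rep (proj x) i‖ ^ 2 ≤ ∑ _i : Fin d, (1 : ℝ) := by
        refine Finset.sum_le_sum fun i _ => ?_
        have h := (AddCircle.equivIco (1 : ℝ) 0 (proj x i)).2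
        have h2 : rep (proj x) i ∈ Ico (0 : ℝ) (0 + 1) := h
        rw [Real.norm_eq_abs, sq_abs]
        nlinarith [h2.1, h2.2]
    _ = d := by simp

theorem exists_lipschitz {d : ℕ} {b : Torus d → Space d} (hb : IsC1 b) :
    ∃ K : NNReal, LipschitzWith K fun x : Space d => b (proj x) := by
  obtain ⟨K, hK⟩ := exists_bound (hb.continuous_fderiv one_ne_zero) (by
    intro x x' h
    obtain ⟨k, rfl⟩ := proj_eq_iff.1 h
    rw [← fderiv_comp_add_right]
    congr 1
    funext z
    rw [proj_eq_iff.2 ⟨k, rfl⟩])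
  exact ⟨K, lipschitzWith_of_nnnorm_fderiv_le (hb.differentiable one_ne_zero) fun x => hK x⟩

/-- A `C^1` vector field on the torus has a global flow. -/
theorem exists_isFlow {d : ℕ} {b : Torus d → Space d} (hb : IsC1 b) : ∃ X, IsFlow b X := by
  obtain ⟨K, hK⟩ := exists_lipschitz hb
  obtain ⟨L, hL⟩ := exists_bound (ContDiff.continuous hb) fun x x' h => by rw [h]
  suffices h : ∀ x : Space d, ∃ γ : ℝ → Space d, γ 0 = x ∧
      ∀ t, HasDerivAt γ (b (proj (γ t))) t by
    choose γ h0 hγ using h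
    exact ⟨fun t x => γ x t, fun x => ⟨h0 x, hγ x⟩⟩
  intro x
  have hloc : ∀ n : ℕ, ∃ γ : ℝ → Space d, γ 0 = x ∧
      ∀ t ∈ Ioo (-(n + 1 : ℝ)) (n + 1), HasDerivAt γ (b (proj (γ t))) t := by
    intro n
    have hn : (0 : ℝ) ≤ n := n.cast_nonneg
    have hpl : IsPicardLindelof (fun _ x => b (proj x)) (tmin := -(n + 1 : ℝ)) (tmax := n + 1)
        ⟨0, by constructor <;> linarith⟩ x (L * (n + 1)) 0 L K :=
      { lipschitzOnWith := fun t _ => hK.lipschitzOnWith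
        continuousOn := fun _ _ => continuousOn_const
        norm_le := fun _ _ x _ => hL x
        mul_max_le := by simp }
    obtain ⟨γ, h0, hγ⟩ := hpl.exists_eq_forall_mem_Icc_hasDerivWithinAt₀
    exact ⟨γ, h0, fun t ht => (hγ t (Ioo_subset_Icc_self ht)).hasDerivAt (Icc_mem_nhds ht.1 ht.2)⟩
  choose γ h0 hγ using hloc
  have key : ∀ m n : ℕ, m ≤ n → EqOn (γ m) (γ n) (Ioo (-(m + 1 : ℝ)) (m + 1)) := by
    intro m n hmn
    have hmn' : (m : ℝ) ≤ n := by exact_mod_cast hmn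
    have hm : (0 : ℝ) ≤ m := m.cast_nonneg
    refine ODE_solution_unique_of_mem_Ioo (v := fun _ x => b (proj x)) (s := fun _ => univ)
      (K := K) (t₀ := 0) (fun _ _ => hK.lipschitzOnWith) ⟨by linarith, by linarith⟩
      (fun t ht => ⟨hγ m t ht, trivial⟩)
      (fun t ht => ⟨hγ n t ⟨by linarith [ht.1], by linarith [ht.2]⟩, trivial⟩) ?_
    rw [h0, h0]
  refine ⟨fun t => γ ⌊|t|⌋₊ t, by simp [h0], fun t => ?_⟩
  have hmem : ∀ s : ℝ, s ∈ Ioo (-((⌊|s|⌋₊ : ℝ) + 1)) (⌊|s|⌋₊ + 1) := fun s =>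
    abs_lt.1 (Nat.lt_floor_add_one |s|)
  have heq : EqOn (fun s => γ ⌊|s|⌋₊ s) (γ ⌊|t|⌋₊) (Ioo (-((⌊|t|⌋₊ : ℝ) + 1)) (⌊|t|⌋₊ + 1)) := by
    intro s hs
    rcases le_total ⌊|s|⌋₊ ⌊|t|⌋₊ with h | h
    · exact key _ _ h (hmem s)
    · exact (key _ _ h hs).symm
  exact (hγ _ t (hmem t)).congr_of_eventuallyEq
    (heq.eventuallyEq_of_mem (Ioo_mem_nhds (hmem t).1 (hmem t).2))

/-- The flow `X(t,x)` on `ℝ^d` of a vector field on the torus; it is pinned down by `isFlow_flow` and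
`IsFlow.unique` when the field is `C^1` (and is a junk value if no flow exists). -/
noncomputable def flow {d : ℕ} (b : Torus d → Space d) : ℝ → Space d → Space d :=
  open Classical in if h : ∃ X, IsFlow b X then h.choose else fun _ x => x

theorem isFlow_flow {d : ℕ} {b : Torus d → Space d} (hb : IsC1 b) : IsFlow b (flow b) := by
  have h := exists_isFlow hb
  rw [flow, dif_pos h]
  exact h.choose_spec

theorem IsFlow.unique {d : ℕ} {b : Torus d → Space d} (hb : IsC1 b)
    {X X' : ℝ → Space d → Space d} (hX : IsFlow b X) (hX' : IsFlow b X') : X = X' := by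
  obtain ⟨K, hK⟩ := exists_lipschitz hb
  funext t x
  have := ODE_solution_unique_univ (v := fun _ x => b (proj x)) (s := fun _ => univ)
      (K := K) (t₀ := 0) (fun _ => hK.lipschitzOnWith) (fun t => ⟨(hX x).2 t, trivial⟩)
      (fun t => ⟨(hX' x).2 t, trivial⟩) (by rw [(hX x).1, (hX' x).1])
  exact congrFun this t

/-- The flow on the torus induced by the flow on `ℝ^d`. -/
noncomputable def torusFlow {d : ℕ} (b : Torus d → Space d) (t : ℝ) (y : Torus d) : Torus d :=
  proj (flow b t (rep y))

/-- The induced flow does not depend on the choice of representatives. -/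
theorem torusFlow_proj {d : ℕ} {b : Torus d → Space d} (hb : IsC1 b) (t : ℝ) (x : Space d) :
    torusFlow b t (proj x) = proj (flow b t x) := by
  obtain ⟨K, hK⟩ := exists_lipschitz hb
  have hX := isFlow_flow hb
  obtain ⟨k, hk⟩ := proj_eq_iff.1 (proj_rep (proj x)).symm
  set c : Space d := WithLp.toLp 2 fun i => (k i : ℝ) with hc
  have hper : ∀ z, proj (z + c) = proj z := fun z => (proj_eq_iff.2 ⟨k, rfl⟩).symm
  have := ODE_solution_unique_univ (v := fun _ x => b (proj x)) (s := fun _ => univ)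
      (f := fun s => flow b s (rep (proj x))) (g := fun s => flow b s x + c)
      (K := K) (t₀ := 0) (fun _ => hK.lipschitzOnWith) (fun t => ⟨(hX _).2 t, trivial⟩)
      (fun t => ⟨by simpa only [hper] using ((hX x).2 t).add_const c, trivial⟩)
      (by simp only [(hX _).1]; exact hk)
  rw [torusFlow, congrFun this t, hper]

/-- The set `𝓘_b` of the Borel probability measures on the torus that are invariant for the flow
of `b`. -/
def invariantMeasures {d : ℕ} (b : Torus d → Space d) : Set (Measure (Torus d)) :=
  {μ | IsProbabilityMeasure μ ∧
    ∀ (t : ℝ) (ψ : C(Torus d, ℝ)), ∫ y, ψ (torusFlow b t y) ∂μ = ∫ y, ψ y ∂μ}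

/-- The flow of `b` is ergodic with respect to the invariant probability measure `μ`: every
`μ`-integrable function that is invariant for the flow with respect to `μ` is `μ`-a.e. equal to its
`μ`-mean. -/
def IsErgodicFor {d : ℕ} (b : Torus d → Space d) (μ : Measure (Torus d)) : Prop :=
  μ ∈ invariantMeasures b ∧
    ∀ f : Torus d → ℝ, Integrable f μ → (∀ t : ℝ, ∀ᵐ y ∂μ, f (torusFlow b t y) = f y) →
      ∀ᵐ y ∂μ, f y = ∫ z, f z ∂μ

/-- Herman's rotation set `C_b`. -/
def rotationSet {d : ℕ} (b : Torus d → Space d) : Set (Space d) :=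
  {z | ∃ μ ∈ invariantMeasures b, z = ∫ y, b y ∂μ}

/-- The subset `D_b` of the rotation set given by the invariant probability measures `σ(y) dy`
with `σ ∈ L^1`. -/
def acRotationSet {d : ℕ} (b : Torus d → Space d) : Set (Space d) :=
  {z | ∃ σ : Torus d → ℝ, Integrable σ volume ∧ (∀ᵐ y, 0 ≤ σ y) ∧
    volume.withDensity (fun y => ENNReal.ofReal (σ y)) ∈ invariantMeasures b ∧
    z = ∫ y, σ y • b y}

/-- `ξ` has incommensurable coordinates: they are linearly independent over the rationals. -/
def HasIncommensurableCoordinates {d : ℕ} (ξ : Space d) : Prop :=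
  ∀ k : Fin d → ℤ, k ≠ 0 → ∑ i, (k i : ℝ) * ξ i ≠ 0

end TorusFlow

open TorusFlow

/-!
The trajectories of `b = ρ ξ` run along the lines of direction `ξ`, so its flow `S` is a time change
of the linear flow `y ↦ y + s ξ`, for which Lebesgue measure is invariant and, as `ξ` is
incommensurable, essentially the only invariant measure. Everything is read off on the characters
`e_k` of the torus, which determine finite measures (`ext_of_integral_mFourier`).

*Structure of invariant measures.* If `ν` is a finite invariant measure, differentiating the constant
`t ↦ ∫ e_k ∘ S_t dν` at `0` gives `2πi (k · ξ) ∫ ρ e_k dν = 0`, hence `ρ ν` is a multiple of Lebesgue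
measure (`withDensity_ofReal_eq_smul_volume`). Dividing by `ρ`, the part of `ν` off the zero set `Z`
of `ρ` is a multiple of `ρ⁻¹ dx` (`restrict_eq_smul_timeMeasure`). This gives uniqueness, and
`∫ b dν = ν(Zᶜ) ζ` for every invariant probability measure `ν`, thus `C_b ⊆ [0, ζ]` and `D_b ⊆ {ζ}`.
Zeros of `ρ` are fixed points of `S`, so mixtures of a Dirac mass and `ρ⁻¹ dx` fill the segment.

*Invariance of `ρ⁻¹ dx`* (`map_torusFlow_timeMeasure`). The derivative of `∫ e_k ∘ S_t ρ⁻¹ dx` in `t`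
is the integral of the derivative of `e_k ∘ S_t` in the direction `ξ`: this directional derivative
exists off `Z` because there `S` moves along `ξ` with nonzero speed. By Gronwall's inequality
`e_k ∘ S_t` is Lipschitz, so its directional derivative is integrated by dominated convergence, and
the integral vanishes since Lebesgue measure is translation invariant.

*Ergodicity* (`isErgodicFor_of_unique`). The positive and negative parts of an invariant function are
densities of invariant measures; by uniqueness these are multiples of `μ`, so the densities are
constant.
-/

namespace TorusFlow

variable {d : ℕ}

/-! ### Fourier analysis on the torus -/

theorem isOpenQuotientMap_proj : IsOpenQuotientMap (proj : Space d → Torus d) :=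
  (IsOpenQuotientMap.piMap fun _ : Fin d =>
    (QuotientAddGroup.isOpenQuotientMap_mk :
      IsOpenQuotientMap ((↑) : ℝ → UnitAddCircle))).comp
    (EuclideanSpace.equiv (Fin d) ℝ).toHomeomorph.isOpenQuotientMap

theorem continuous_proj : Continuous (proj : Space d → Torus d) :=
  isOpenQuotientMap_proj.continuous

theorem proj_add (x x' : Space d) : proj (x + x') = proj x + proj x' := by
  funext i
  simp [proj]

theorem IsC1.continuous {F : Type*} [NormedAddCommGroup F] [NormedSpace ℝ F] {f : Torus d → F}
    (hf : IsC1 f) : Continuous f :=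
  isOpenQuotientMap_proj.isQuotientMap.continuous_iff.2 (ContDiff.continuous hf)

instance isProbabilityMeasure_unitAddCircle :
    IsProbabilityMeasure (volume : Measure UnitAddCircle) :=
  ⟨UnitAddCircle.measure_univ⟩

instance nullSingletonClass_unitAddCircle :
    NullSingletonClass (volume : Measure UnitAddCircle) :=
  ⟨fun x => by simpa using AddCircle.volume_closedBall (T := 1) (x := x) 0⟩

/-- The linear form `x ↦ 2π k · x`, so that the character `e_k` is `exp (i phase k)`. -/
noncomputable def phase (k : Fin d → ℤ) : Space d →L[ℝ] ℝ :=
  (2 * Real.pi) • innerSL ℝ (WithLp.toLp 2 fun i => (k i : ℝ) : Space d)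

theorem phase_apply (k : Fin d → ℤ) (x : Space d) :
    phase k x = 2 * Real.pi * ∑ i, (k i : ℝ) * x i := by
  simp [phase, PiLp.inner_apply, mul_comm]

theorem mFourier_proj (k : Fin d → ℤ) (x : Space d) :
    UnitAddTorus.mFourier k (proj x) = Complex.exp (phase k x * Complex.I) := by
  simp only [UnitAddTorus.mFourier, ContinuousMap.coe_mk, proj, fourier_coe_apply,
    ← Complex.exp_sum, phase_apply]
  congr 1
  push_cast
  rw [Finset.mul_sum, Finset.sum_mul]
  refine Finset.sum_congr rfl fun i _ => ?_
  ring

theorem integrable_of_continuous (μ : Measure (Torus d)) [IsFiniteMeasure μ] {F : Type*}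
    [NormedAddCommGroup F] [SecondCountableTopologyEither (Torus d) F] {f : Torus d → F}
    (hf : Continuous f) : Integrable f μ :=
  hf.integrable_of_hasCompactSupport (HasCompactSupport.of_compactSpace f)

/-- Finite measures on the torus are determined by their Fourier coefficients. -/
theorem ext_of_integral_mFourier {μ ν : Measure (Torus d)} [IsFiniteMeasure μ] [IsFiniteMeasure ν]
    (h : ∀ k, ∫ y, UnitAddTorus.mFourier k y ∂μ = ∫ y, UnitAddTorus.mFourier k y ∂ν) : μ = ν := by
  have key : ∀ f : C(Torus d, ℂ), ∫ y, f y ∂μ = ∫ y, f y ∂ν := by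
    intro f
    have hint : ∀ (κ : Measure (Torus d)) [IsFiniteMeasure κ],
        Continuous fun f : C(Torus d, ℂ) => ∫ y, f y ∂κ := by
      intro κ _
      refine continuous_iff_continuousAt.2 fun f => ?_
      have hf := (ContinuousMap.toLp (E := ℂ) 1 κ ℂ).continuous
      have h2 := continuous_integral.comp hf
      refine (h2.congr fun g => ?_).continuousAt
      exact integral_congr_ae (ContinuousMap.coeFn_toLp κ g)
    have hf : f ∈ (Submodule.span ℂ
        (range (UnitAddTorus.mFourier (d := Fin d)))).topologicalClosure := by
      rw [UnitAddTorus.span_mFourier_closure_eq_top]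
      trivial
    refine closure_minimal ?_ (isClosed_eq (hint μ) (hint ν)) hf
    intro g hg
    induction hg using Submodule.span_induction with
    | mem g hg => obtain ⟨k, rfl⟩ := hg; exact h k
    | zero => simp
    | add g₁ g₂ _ _ h₁ h₂ =>
      simp only [mem_ofPred_eq, ContinuousMap.add_apply] at h₁ h₂ ⊢
      rw [integral_add (integrable_of_continuous μ g₁.continuous)
        (integrable_of_continuous μ g₂.continuous),
        integral_add (integrable_of_continuous ν g₁.continuous)
        (integrable_of_continuous ν g₂.continuous), h₁, h₂]
    | smul c g _ h₁ =>
      simp only [mem_ofPred_eq, ContinuousMap.smul_apply, integral_smul] at h₁ ⊢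
      rw [h₁]
  refine ext_of_forall_integral_eq_of_IsFiniteMeasure fun f => ?_
  have := key ⟨fun y => (f y : ℂ), Complex.continuous_ofReal.comp f.continuous⟩
  simp only [ContinuousMap.coe_mk, integral_complex_ofReal] at this
  exact_mod_cast this

/-- A character that is not constant along the direction `ξ` has mean zero: translating by half a
period along `ξ` changes its sign. -/
theorem integral_mFourier_eq_zero {k : Fin d → ℤ} {ξ : Space d} (hk : phase k ξ ≠ 0) :
    ∫ y : Torus d, UnitAddTorus.mFourier k y = 0 := by
  have h := integral_add_right_eq_self (μ := (volume : Measure (Torus d)))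
    (fun y => UnitAddTorus.mFourier k y) (proj ((Real.pi / phase k ξ) • ξ))
  have h2 : ∀ y, UnitAddTorus.mFourier k (y + proj ((Real.pi / phase k ξ) • ξ)) =
      -UnitAddTorus.mFourier k y := by
    intro y
    rw [← proj_rep y, ← proj_add, mFourier_proj, mFourier_proj, map_add, map_smul, smul_eq_mul,
      div_mul_cancel₀ _ hk]
    push_cast
    rw [add_mul, Complex.exp_add, Complex.exp_pi_mul_I, mul_neg_one]
  simp only [h2, integral_neg] at h
  exact self_eq_neg.1 h.symm

theorem phase_ne_zero {ξ : Space d} (hξ : HasIncommensurableCoordinates ξ) {k : Fin d → ℤ}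
    (hk : k ≠ 0) : phase k ξ ≠ 0 := by
  rw [phase_apply]
  exact mul_ne_zero (by positivity) (hξ k hk)

theorem volume_finite_eq_zero (hd : 2 ≤ d) {Z : Set (Torus d)} (hZ : Z.Finite) :
    volume Z = 0 := by
  have : Nonempty (Fin d) := ⟨⟨0, by omega⟩⟩
  exact hZ.measure_zero _

/-! ### The flow of a `C^1` vector field -/

section Flow

variable {b : Torus d → Space d}

theorem flow_zero (hb : IsC1 b) (x : Space d) : flow b 0 x = x :=
  (isFlow_flow hb x).1

theorem hasDerivAt_flow (hb : IsC1 b) (t : ℝ) (x : Space d) :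
    HasDerivAt (fun s => flow b s x) (b (proj (flow b t x))) t :=
  (isFlow_flow hb x).2 t

theorem flow_eq_of_hasDerivAt (hb : IsC1 b) {γ : ℝ → Space d}
    (hγ : ∀ t, HasDerivAt γ (b (proj (γ t))) t) (t : ℝ) : γ t = flow b t (γ 0) := by
  obtain ⟨K, hK⟩ := exists_lipschitz hb
  have := ODE_solution_unique_univ (v := fun _ x => b (proj x)) (s := fun _ => univ)
      (K := K) (t₀ := 0) (fun _ => hK.lipschitzOnWith) (fun t => ⟨hγ t, trivial⟩)
      (fun t => ⟨hasDerivAt_flow hb t (γ 0), trivial⟩) (flow_zero hb _).symm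
  exact congrFun this t

theorem flow_add (hb : IsC1 b) (s t : ℝ) (x : Space d) :
    flow b (s + t) x = flow b s (flow b t x) := by
  have := flow_eq_of_hasDerivAt hb (γ := fun s => flow b (s + t) x)
    (fun s => (hasDerivAt_flow hb (s + t) x).comp_add_const s t) s
  simpa using this

theorem dist_flow_le (hb : IsC1 b) :
    ∃ K : NNReal, ∀ t x x', dist (flow b t x) (flow b t x') ≤ dist x x' * Real.exp (K * |t|) := by
  obtain ⟨K, hK⟩ := exists_lipschitz hb
  refine ⟨K, fun t x x' => ?_⟩
  have hc : ∀ x, Continuous fun s => flow b s x := fun x =>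
    continuous_iff_continuousAt.2 fun s => (hasDerivAt_flow hb s x).continuousAt
  rcases le_total 0 t with ht | ht
  · have := dist_le_of_trajectories_ODE (v := fun _ x => b (proj x)) (K := K) (a := 0) (b := t)
      (δ := dist x x') (fun _ => hK) (hc x).continuousOn
      (fun s _ => (hasDerivAt_flow hb s x).hasDerivWithinAt) (hc x').continuousOn
      (fun s _ => (hasDerivAt_flow hb s x').hasDerivWithinAt)
      (by rw [flow_zero hb, flow_zero hb]) t ⟨ht, le_rfl⟩
    simpa [abs_of_nonneg ht] using this
  · -- Backwards in time the trajectories solve the equation of the field `-b`.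
    have hd' : ∀ x s, HasDerivAt (fun s => flow b (-s) x) (-b (proj (flow b (-s) x))) s := by
      intro x s
      rw [← neg_one_smul ℝ]
      exact (hasDerivAt_flow hb (-s) x).scomp s (hasDerivAt_neg s)
    have := dist_le_of_trajectories_ODE (v := fun _ x => -b (proj x)) (K := K) (a := 0) (b := -t)
      (δ := dist x x') (fun _ => hK.neg) ((hc x).comp continuous_neg).continuousOn
      (fun s _ => (hd' x s).hasDerivWithinAt) ((hc x').comp continuous_neg).continuousOn
      (fun s _ => (hd' x' s).hasDerivWithinAt)
      (by simp [flow_zero hb]) (-t) ⟨by linarith, le_rfl⟩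
    simpa [abs_of_nonpos ht] using this

theorem continuous_flow (hb : IsC1 b) (t : ℝ) : Continuous (flow b t) := by
  obtain ⟨K, hK⟩ := dist_flow_le hb
  exact (LipschitzWith.of_dist_le_mul (K := (Real.exp (K * |t|)).toNNReal) fun x x' => by
    rw [Real.coe_toNNReal _ (Real.exp_nonneg _), mul_comm]
    exact hK t x x').continuous

theorem continuous_torusFlow (hb : IsC1 b) (t : ℝ) : Continuous (torusFlow b t) :=
  isOpenQuotientMap_proj.isQuotientMap.continuous_iff.2
    ((continuous_proj.comp (continuous_flow hb t)).congr fun x => (torusFlow_proj hb t x).symm)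

theorem torusFlow_zero (hb : IsC1 b) (y : Torus d) : torusFlow b 0 y = y := by
  rw [torusFlow, flow_zero hb, proj_rep]

theorem torusFlow_add (hb : IsC1 b) (s t : ℝ) (y : Torus d) :
    torusFlow b (s + t) y = torusFlow b s (torusFlow b t y) := by
  conv_lhs => rw [torusFlow, flow_add hb]
  rw [torusFlow.eq_1 b t y, torusFlow_proj hb]

theorem torusFlow_eq_self (hb : IsC1 b) {y : Torus d} (hy : b y = 0) (t : ℝ) :
    torusFlow b t y = y := by
  rw [torusFlow, ← flow_eq_of_hasDerivAt hb (γ := fun _ => rep y) (fun t => ?_) t, proj_rep]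
  rw [proj_rep, hy]
  exact hasDerivAt_const t _

theorem hasDerivAt_mFourier_torusFlow (hb : IsC1 b) (k : Fin d → ℤ) (t : ℝ) (y : Torus d) :
    HasDerivAt (fun s => UnitAddTorus.mFourier k (torusFlow b s y))
      (UnitAddTorus.mFourier k (torusFlow b t y) * (phase k (b (torusFlow b t y)) * Complex.I)) t := by
  simp only [torusFlow, mFourier_proj]
  have h := (phase k).hasFDerivAt.comp_hasDerivAt t (hasDerivAt_flow hb t (rep y))
  exact (h.ofReal_comp.mul_const Complex.I).cexp

theorem norm_mFourier_apply (k : Fin d → ℤ) (y : Torus d) :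
    ‖UnitAddTorus.mFourier k y‖ = 1 := by
  rw [← proj_rep y, mFourier_proj, Complex.norm_exp_ofReal_mul_I]

theorem hasDerivAt_integral_mFourier_torusFlow (hb : IsC1 b) (ν : Measure (Torus d))
    [IsFiniteMeasure ν] (k : Fin d → ℤ) (t : ℝ) :
    HasDerivAt (fun s => ∫ y, UnitAddTorus.mFourier k (torusFlow b s y) ∂ν)
      (∫ y, UnitAddTorus.mFourier k (torusFlow b t y) *
        (phase k (b (torusFlow b t y)) * Complex.I) ∂ν) t := by
  have hcont : Continuous fun y => phase k (b y) := (phase k).continuous.comp hb.continuous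
  obtain ⟨C, hC⟩ := isCompact_univ.exists_bound_of_continuousOn hcont.continuousOn
  have hF : ∀ s, Continuous fun y => UnitAddTorus.mFourier k (torusFlow b s y) := fun s =>
    (UnitAddTorus.mFourier k).continuous.comp (continuous_torusFlow hb s)
  refine (hasDerivAt_integral_of_dominated_loc_of_deriv_le (bound := fun _ => C)
    (F := fun s y => UnitAddTorus.mFourier k (torusFlow b s y))
    (F' := fun s y => UnitAddTorus.mFourier k (torusFlow b s y) *
        (phase k (b (torusFlow b s y)) * Complex.I)) Filter.univ_mem
    (.of_forall fun s => (hF s).aestronglyMeasurable) (integrable_of_continuous ν (hF t)) ?_ ?_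
    (integrable_const C) (.of_forall fun y s _ => hasDerivAt_mFourier_torusFlow hb k s y)).2
  · exact ((hF t).mul ((Complex.continuous_ofReal.comp
      (hcont.comp (continuous_torusFlow hb t))).mul continuous_const)).aestronglyMeasurable
  · refine .of_forall fun y s _ => ?_
    rw [norm_mul, norm_mFourier_apply, one_mul, norm_mul, Complex.norm_I, mul_one,
      Complex.norm_real]
    exact hC _ trivial

theorem mem_invariantMeasures_iff (hb : IsC1 b) {μ : Measure (Torus d)} :
    μ ∈ invariantMeasures b ↔ IsProbabilityMeasure μ ∧ ∀ t, μ.map (torusFlow b t) = μ := by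
  refine and_congr_right fun hμ => forall_congr' fun t => ?_
  have hm := continuous_torusFlow hb t
  refine ⟨fun h => ?_, fun h ψ => ?_⟩
  · refine ext_of_forall_integral_eq_of_IsFiniteMeasure fun f => ?_
    rw [integral_map hm.aemeasurable f.continuous.aestronglyMeasurable]
    exact h f.toContinuousMap
  · conv_rhs => rw [← h]
    rw [integral_map hm.aemeasurable ψ.continuous.aestronglyMeasurable]

end Flow

/-! ### The time change of a linear flow -/

section Stepanoff

variable {ρ : Torus d → ℝ} {ξ : Space d}

/-- The vector field `ρ ξ` on the torus, of constant direction `ξ`. -/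
def stepanoffField (ρ : Torus d → ℝ) (ξ : Space d) : Torus d → Space d := fun y => ρ y • ξ

theorem isC1_stepanoffField (hρ : IsC1 ρ) (ξ : Space d) : IsC1 (stepanoffField ρ ξ) :=
  ContDiff.smul hρ contDiff_const

/-- The signed distance, in units of `ξ`, which the point `x` has travelled at time `t`. -/
noncomputable def travel (ρ : Torus d → ℝ) (ξ : Space d) (x : Space d) (t : ℝ) : ℝ :=
  ∫ s in (0 : ℝ)..t, ρ (proj (flow (stepanoffField ρ ξ) s x))

theorem continuous_speed (hρ : IsC1 ρ) (x : Space d) :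
    Continuous fun s => ρ (proj (flow (stepanoffField ρ ξ) s x)) :=
  hρ.continuous.comp (continuous_proj.comp (continuous_iff_continuousAt.2 fun s =>
    (hasDerivAt_flow (isC1_stepanoffField hρ ξ) s x).continuousAt))

theorem hasDerivAt_travel (hρ : IsC1 ρ) (x : Space d) (t : ℝ) :
    HasDerivAt (travel ρ ξ x) (ρ (proj (flow (stepanoffField ρ ξ) t x))) t :=
  (continuous_speed hρ x).integral_hasStrictDerivAt 0 t |>.hasDerivAt

theorem flow_stepanoffField (hρ : IsC1 ρ) (x : Space d) (t : ℝ) :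
    flow (stepanoffField ρ ξ) t x = x + travel ρ ξ x t • ξ := by
  have hb := isC1_stepanoffField hρ ξ
  have hderiv : ∀ s, HasDerivAt
      (fun s => flow (stepanoffField ρ ξ) s x - travel ρ ξ x s • ξ) 0 s := by
    intro s
    have h := (hasDerivAt_flow hb s x).sub ((hasDerivAt_travel (ξ := ξ) hρ x s).smul_const ξ)
    rwa [stepanoffField, sub_self] at h
  have := is_const_of_deriv_eq_zero (fun s => (hderiv s).differentiableAt)
    (fun s => (hderiv s).deriv) t 0
  rw [flow_zero hb] at this
  rw [← sub_eq_iff_eq_add, this]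
  simp [travel]

/-- Off the zero set of `ρ`, moving along `ξ` amounts to moving along the flow, at speed `ρ`; so a
function of the form `e_k ∘ S_t` has a derivative in the direction `ξ`, although `S_t` need not be
differentiable there a priori. -/
theorem hasDerivAt_mFourier_torusFlow_add_smul (hρ : IsC1 ρ) (k : Fin d → ℤ) (t : ℝ) {y : Torus d}
    (hy : ρ y ≠ 0) :
    HasDerivAt (fun s : ℝ => UnitAddTorus.mFourier k (torusFlow (stepanoffField ρ ξ) t
        (y + proj (s • ξ))))
      ((ρ y)⁻¹ • (UnitAddTorus.mFourier k (torusFlow (stepanoffField ρ ξ) t y) *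
        (phase k (stepanoffField ρ ξ (torusFlow (stepanoffField ρ ξ) t y)) * Complex.I))) 0 := by
  have hb := isC1_stepanoffField hρ ξ
  set b := stepanoffField ρ ξ with hbdef
  set x := rep y with hx
  have hxy : proj x = y := proj_rep y
  have hstrict : HasStrictDerivAt (travel ρ ξ x) (ρ y) 0 := by
    have h := (continuous_speed (ξ := ξ) hρ x).integral_hasStrictDerivAt 0 0
    rwa [flow_zero hb, hxy] at h
  have h0 : travel ρ ξ x 0 = 0 := by simp [travel]
  -- `g s` is the time at which the trajectory of `y` passes through `y + s ξ`.
  set g := hstrict.localInverse _ _ _ hy with hg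
  have hg' : HasDerivAt g (ρ y)⁻¹ 0 := by
    have := (hstrict.to_localInverse hy).hasDerivAt
    rwa [h0] at this
  have hright : ∀ᶠ s in 𝓝 (0 : ℝ), travel ρ ξ x (g s) = s := by
    have := hstrict.eventually_right_inverse hy
    rwa [h0] at this
  have hg0 : g 0 = 0 := by
    have := (hstrict.eventually_left_inverse hy).self_of_nhds
    rwa [h0] at this
  have hcomp := (hasDerivAt_mFourier_torusFlow hb k (t + g 0) y).scomp 0 (hg'.const_add t)
  rw [hg0, add_zero] at hcomp
  refine hcomp.congr_of_eventuallyEq ?_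
  filter_upwards [hright] with s hs
  have : torusFlow b (g s) y = y + proj (s • ξ) := by
    rw [torusFlow, ← hx, hbdef, flow_stepanoffField hρ, hs, proj_add, hxy]
  rw [Function.comp_apply, torusFlow_add hb, this]

theorem norm_mFourier_proj_sub_le (k : Fin d → ℤ) (x x' : Space d) :
    ‖UnitAddTorus.mFourier k (proj x) - UnitAddTorus.mFourier k (proj x')‖ ≤
      ‖phase k‖ * dist x x' := by
  have h : UnitAddTorus.mFourier k (proj x) - UnitAddTorus.mFourier k (proj x') =
      Complex.exp (phase k x' * Complex.I) *
        (Complex.exp (Complex.I * (phase k (x - x') : ℝ)) - 1) := by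
    rw [mFourier_proj, mFourier_proj, mul_sub, ← Complex.exp_add, map_sub]
    congr 2
    · push_cast; ring
    · ring
  rw [h, norm_mul, Complex.norm_exp_ofReal_mul_I, one_mul, dist_eq_norm]
  exact Real.norm_exp_I_mul_ofReal_sub_one_le.trans ((phase k).le_opNorm _)

/-- The derivative of `e_k ∘ S_t` in the direction `ξ` has mean zero, because Lebesgue measure is
invariant under translations along `ξ`. -/
theorem integral_deriv_mFourier_torusFlow (hρ : IsC1 ρ) (hzero : volume {y | ρ y = 0} = 0)
    (k : Fin d → ℤ) (t : ℝ) :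
    ∫ y, (ρ y)⁻¹ • (UnitAddTorus.mFourier k (torusFlow (stepanoffField ρ ξ) t y) *
        (phase k (stepanoffField ρ ξ (torusFlow (stepanoffField ρ ξ) t y)) * Complex.I)) = 0 := by
  have hb := isC1_stepanoffField hρ ξ
  set b := stepanoffField ρ ξ with hbdef
  obtain ⟨K, hK⟩ := dist_flow_le hb
  have hS := continuous_torusFlow hb t
  have hG : Continuous fun y => UnitAddTorus.mFourier k (torusFlow b t y) :=
    (UnitAddTorus.mFourier k).continuous.comp hS
  have hF : ∀ s : ℝ, Continuous fun y => UnitAddTorus.mFourier k (torusFlow b t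
      (y + proj (s • ξ))) := fun s => hG.comp (continuous_add_const _)
  have hlip : ∀ y, LipschitzWith
      (Real.nnabs (‖phase k‖ * (Real.exp (K * |t|) * ‖ξ‖))) fun s : ℝ =>
        UnitAddTorus.mFourier k (torusFlow b t (y + proj (s • ξ))) := by
    intro y
    refine LipschitzWith.of_dist_le_mul fun s s' => ?_
    rw [← proj_rep y, ← proj_add, ← proj_add, torusFlow_proj hb, torusFlow_proj hb, dist_eq_norm,
      Real.coe_nnabs, abs_of_nonneg (by positivity)]
    refine (norm_mFourier_proj_sub_le k _ _).trans ?_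
    rw [mul_assoc]
    refine mul_le_mul_of_nonneg_left ((hK t _ _).trans (le_of_eq ?_)) (norm_nonneg _)
    rw [dist_add_left, dist_eq_norm, dist_eq_norm, ← sub_smul, norm_smul]
    ring
  have hmeas : Measurable fun y => (ρ y)⁻¹ • (UnitAddTorus.mFourier k (torusFlow b t y) *
        (phase k (b (torusFlow b t y)) * Complex.I)) := by
    refine hρ.continuous.measurable.inv.smul (hG.mul ((Complex.continuous_ofReal.comp
      ((phase k).continuous.comp (hb.continuous.comp hS))).mul continuous_const)).measurable
  have key := (hasDerivAt_integral_of_dominated_loc_of_lip (μ := (volume : Measure (Torus d)))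
    (x₀ := (0 : ℝ)) (bound := fun _ => ‖phase k‖ * (Real.exp (K * |t|) * ‖ξ‖))
    (F := fun s y => UnitAddTorus.mFourier k (torusFlow b t (y + proj (s • ξ))))
    Filter.univ_mem (.of_forall fun s => (hF s).aestronglyMeasurable)
    (integrable_of_continuous _ (hF 0)) hmeas.aestronglyMeasurable
    (.of_forall fun y => (hlip y).lipschitzOnWith) (integrable_const _)
    (by
      filter_upwards [measure_eq_zero_iff_ae_notMem.1 hzero] with y hy
      exact hasDerivAt_mFourier_torusFlow_add_smul hρ k t hy)).2
  refine key.unique ?_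
  simp only [integral_add_right_eq_self (μ := (volume : Measure (Torus d)))
    (fun y => UnitAddTorus.mFourier k (torusFlow b t y))]
  exact hasDerivAt_const _ _

end Stepanoff

/-! ### Invariant measures of the time-changed flow -/

section TimeMeasure

variable {ρ : Torus d → ℝ} {ξ : Space d}

/-- The measure `ρ⁻¹ dx` on the torus, for which the mass of a piece of trajectory is the time
spent on it. -/
noncomputable def timeMeasure (ρ : Torus d → ℝ) : Measure (Torus d) :=
  volume.withDensity fun y => ENNReal.ofReal (1 / ρ y)

theorem timeMeasure_univ (hρ_nonneg : ∀ y, 0 ≤ ρ y)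
    (hσ : Integrable (fun y => 1 / ρ y) volume) :
    timeMeasure ρ univ = ENNReal.ofReal (∫ y, 1 / ρ y) := by
  rw [timeMeasure, withDensity_apply _ MeasurableSet.univ, Measure.restrict_univ,
    ofReal_integral_eq_lintegral_ofReal hσ (.of_forall fun y => one_div_nonneg.2 (hρ_nonneg y))]

theorem isFiniteMeasure_timeMeasure (hσ : Integrable (fun y => 1 / ρ y) volume) :
    IsFiniteMeasure (timeMeasure ρ) :=
  isFiniteMeasure_withDensity_ofReal hσ.2

theorem integral_timeMeasure {E : Type*} [NormedAddCommGroup E] [NormedSpace ℝ E] (hρ : IsC1 ρ)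
    (hρ_nonneg : ∀ y, 0 ≤ ρ y) (F : Torus d → E) :
    ∫ y, F y ∂timeMeasure ρ = ∫ y, (ρ y)⁻¹ • F y := by
  rw [timeMeasure, integral_withDensity_eq_integral_toReal_smul₀
    (hρ.continuous.measurable.const_div 1).ennreal_ofReal.aemeasurable
    (.of_forall fun y => ENNReal.ofReal_lt_top)]
  refine integral_congr_ae (.of_forall fun y => ?_)
  simp only
  rw [ENNReal.toReal_ofReal (one_div_nonneg.2 (hρ_nonneg y)), one_div]

/-- The flow of `ρ ξ` preserves `ρ⁻¹ dx`: integrating the time derivative of `e_k ∘ S_t` against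
`ρ⁻¹ dx` is integrating its derivative in the direction `ξ` against Lebesgue measure. -/
theorem map_torusFlow_timeMeasure (hρ : IsC1 ρ) (hρ_nonneg : ∀ y, 0 ≤ ρ y)
    (hzero : volume {y | ρ y = 0} = 0) (hσ : Integrable (fun y => 1 / ρ y) volume) (t : ℝ) :
    (timeMeasure ρ).map (torusFlow (stepanoffField ρ ξ) t) = timeMeasure ρ := by
  have := isFiniteMeasure_timeMeasure hσ
  have hb := isC1_stepanoffField hρ ξ
  refine ext_of_integral_mFourier fun k => ?_
  rw [integral_map (continuous_torusFlow hb t).aemeasurable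
    (UnitAddTorus.mFourier k).continuous.aestronglyMeasurable]
  have hderiv : ∀ s, HasDerivAt (fun s => ∫ y, UnitAddTorus.mFourier k
      (torusFlow (stepanoffField ρ ξ) s y) ∂timeMeasure ρ) 0 s := by
    intro s
    have h := hasDerivAt_integral_mFourier_torusFlow hb (timeMeasure ρ) k s
    rwa [integral_timeMeasure hρ hρ_nonneg, integral_deriv_mFourier_torusFlow hρ hzero] at h
  have := is_const_of_deriv_eq_zero (fun s => (hderiv s).differentiableAt)
    (fun s => (hderiv s).deriv) t 0
  simpa only [torusFlow_zero hb] using this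

/-- If `ν` is invariant for the flow of `ρ ξ`, then `ρ ν` is a multiple of Lebesgue measure: the
derivative of `t ↦ ∫ e_k ∘ S_t dν` at `0` is `2πi (k · ξ)` times the integral of `e_k` against
`ρ ν`. -/
theorem withDensity_ofReal_eq_smul_volume (hρ : IsC1 ρ) (hρ_nonneg : ∀ y, 0 ≤ ρ y)
    (hξ : HasIncommensurableCoordinates ξ) (ν : Measure (Torus d)) [IsFiniteMeasure ν]
    (hν : ∀ t, ν.map (torusFlow (stepanoffField ρ ξ) t) = ν) :
    ∃ c : ENNReal, ν.withDensity (fun y => ENNReal.ofReal (ρ y)) = c • volume := by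
  have hb := isC1_stepanoffField hρ ξ
  have hfin : IsFiniteMeasure (ν.withDensity fun y => ENNReal.ofReal (ρ y)) :=
    isFiniteMeasure_withDensity_ofReal (integrable_of_continuous ν hρ.continuous).2
  set κ := ν.withDensity fun y => ENNReal.ofReal (ρ y) with hκ
  refine ⟨κ univ, ?_⟩
  have hfin' : IsFiniteMeasure (κ univ • (volume : Measure (Torus d))) :=
    Measure.smul_finite _ (measure_ne_top _ _)
  refine ext_of_integral_mFourier fun k => ?_
  rw [integral_smul_measure]
  rcases eq_or_ne k 0 with rfl | hk
  · simp [UnitAddTorus.mFourier_zero, measureReal_def]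
  rw [integral_mFourier_eq_zero (phase_ne_zero hξ hk), smul_zero, hκ,
    integral_withDensity_eq_integral_toReal_smul₀
    hρ.continuous.measurable.ennreal_ofReal.aemeasurable
    (.of_forall fun y => ENNReal.ofReal_lt_top)]
  have hconst : ∀ t, ∫ y, UnitAddTorus.mFourier k (torusFlow (stepanoffField ρ ξ) t y) ∂ν =
      ∫ y, UnitAddTorus.mFourier k y ∂ν := by
    intro t
    conv_rhs => rw [← hν t]
    rw [integral_map (continuous_torusFlow hb t).aemeasurable
      (UnitAddTorus.mFourier k).continuous.aestronglyMeasurable]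
  have hderiv := hasDerivAt_integral_mFourier_torusFlow hb ν k 0
  simp only [hconst, torusFlow_zero hb] at hderiv
  have h0 := hderiv.unique (hasDerivAt_const _ _)
  have hfactor : ∀ y, UnitAddTorus.mFourier k y *
      (phase k (stepanoffField ρ ξ y) * Complex.I) =
      (phase k ξ * Complex.I) * ((ENNReal.ofReal (ρ y)).toReal • UnitAddTorus.mFourier k y) := by
    intro y
    rw [ENNReal.toReal_ofReal (hρ_nonneg y), stepanoffField, map_smul, Complex.real_smul,
      smul_eq_mul]
    push_cast
    ring
  simp only [hfactor] at h0
  rw [integral_const_mul] at h0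
  refine (mul_eq_zero.1 h0).resolve_left (mul_ne_zero ?_ Complex.I_ne_zero)
  exact_mod_cast phase_ne_zero hξ hk

/-- Off the zero set of `ρ`, every finite invariant measure is a multiple of `ρ⁻¹ dx`. -/
theorem restrict_eq_smul_timeMeasure (hρ : IsC1 ρ) (hρ_nonneg : ∀ y, 0 ≤ ρ y)
    (hξ : HasIncommensurableCoordinates ξ) (ν : Measure (Torus d)) [IsFiniteMeasure ν]
    (hν : ∀ t, ν.map (torusFlow (stepanoffField ρ ξ) t) = ν) :
    ∃ c : ENNReal, ν.restrict {y | ρ y = 0}ᶜ = c • timeMeasure ρ := by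
  obtain ⟨c, hc⟩ := withDensity_ofReal_eq_smul_volume hρ hρ_nonneg hξ ν hν
  refine ⟨c, ?_⟩
  have hm := hρ.continuous.measurable
  have hZ : MeasurableSet {y | ρ y = 0}ᶜ :=
    (isClosed_singleton.preimage hρ.continuous).measurableSet.compl
  rw [timeMeasure, ← withDensity_smul_measure, ← hc,
    ← withDensity_mul _ hm.ennreal_ofReal (hm.const_div 1).ennreal_ofReal,
    ← withDensity_indicator_one hZ]
  congr 1
  funext y
  rcases eq_or_ne (ρ y) 0 with hy | hy
  · simp [hy]
  · rw [Pi.mul_apply, ← ENNReal.ofReal_mul (hρ_nonneg y), mul_one_div_cancel hy,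
      indicator_of_mem (by exact hy)]
    simp

theorem integral_stepanoffField_timeMeasure (hρ : IsC1 ρ) (hρ_nonneg : ∀ y, 0 ≤ ρ y)
    (hzero : volume {y | ρ y = 0} = 0) :
    ∫ y, stepanoffField ρ ξ y ∂timeMeasure ρ = ξ := by
  rw [integral_timeMeasure hρ hρ_nonneg]
  have : (fun y => (ρ y)⁻¹ • stepanoffField ρ ξ y) =ᵐ[volume] fun _ => ξ := by
    filter_upwards [measure_eq_zero_iff_ae_notMem.1 hzero] with y hy
    exact inv_smul_smul₀ hy ξ
  rw [integral_congr_ae this]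
  simp

theorem integral_stepanoffField_eq (hρ : IsC1 ρ) {ν : Measure (Torus d)} {c : ENNReal}
    (hρ_nonneg : ∀ y, 0 ≤ ρ y) (hzero : volume {y | ρ y = 0} = 0)
    (hc : ν.restrict {y | ρ y = 0}ᶜ = c • timeMeasure ρ) :
    ∫ y, stepanoffField ρ ξ y ∂ν = c.toReal • ξ := by
  rw [← setIntegral_eq_integral_of_forall_compl_eq_zero (s := {y | ρ y = 0}ᶜ), hc,
    integral_smul_measure, integral_stepanoffField_timeMeasure hρ hρ_nonneg hzero]
  intro y hy
  rw [notMem_compl_iff] at hy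
  rw [stepanoffField, show ρ y = 0 from hy, zero_smul]

end TimeMeasure

/-! ### Ergodicity from uniqueness of the invariant density -/

section Ergodic

variable {b : Torus d → Space d} {μ : Measure (Torus d)}

theorem map_withDensity_of_comp_ae_eq {α : Type*} [MeasurableSpace α] {μ : Measure α} {S : α → α}
    (hS : Measurable S) (hμ : μ.map S = μ) {g : α → ENNReal} (hg : Measurable g)
    (hgS : ∀ᵐ y ∂μ, g (S y) = g y) : (μ.withDensity g).map S = μ.withDensity g := by
  ext A hA
  rw [Measure.map_apply hS hA, withDensity_apply _ (hS hA), withDensity_apply _ hA]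
  conv_rhs => rw [← hμ]
  rw [setLIntegral_map hA hg hS]
  refine lintegral_congr_ae (ae_restrict_of_ae ?_)
  filter_upwards [hgS] with y hy
  exact hy.symm

/-- An invariant density with respect to `μ` defines an invariant measure; if all absolutely
continuous invariant measures are multiples of `μ`, the density is constant. -/
theorem ae_eq_const_of_unique (hb : IsC1 b) (hμ : ∀ t, μ.map (torusFlow b t) = μ)
    (huniq : ∀ ν : Measure (Torus d), IsFiniteMeasure ν → (∀ t, ν.map (torusFlow b t) = ν) →
      ν ≪ μ → ∃ c : ENNReal, ν = c • μ)
    {g : Torus d → ENNReal} (hg : Measurable g) (hint : ∫⁻ y, g y ∂μ ≠ ⊤)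
    (hgS : ∀ t, ∀ᵐ y ∂μ, g (torusFlow b t y) = g y) : ∃ c : ENNReal, ∀ᵐ y ∂μ, g y = c := by
  obtain ⟨c, hc⟩ := huniq (μ.withDensity g) (isFiniteMeasure_withDensity hint)
    (fun t => map_withDensity_of_comp_ae_eq (continuous_torusFlow hb t).measurable (hμ t) hg
      (hgS t)) (withDensity_absolutelyContinuous _ _)
  rw [← withDensity_const] at hc
  exact ⟨c, (withDensity_eq_iff hg.aemeasurable aemeasurable_const hint).1 hc⟩

/-- If every absolutely continuous finite invariant measure is a multiple of `μ`, then the flow is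
ergodic with respect to `μ`: the positive and negative parts of an invariant function are invariant
densities. -/
theorem isErgodicFor_of_unique [IsProbabilityMeasure μ] (hb : IsC1 b) (hμ : μ ∈ invariantMeasures b)
    (huniq : ∀ ν : Measure (Torus d), IsFiniteMeasure ν → (∀ t, ν.map (torusFlow b t) = ν) →
      ν ≪ μ → ∃ c : ENNReal, ν = c • μ) : IsErgodicFor b μ := by
  refine ⟨hμ, fun f hf hinv => ?_⟩
  have hmap := ((mem_invariantMeasures_iff hb).1 hμ).2
  set f' := hf.1.mk f with hf'
  have hmeas : Measurable f' := hf.1.stronglyMeasurable_mk.measurable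
  have hae : f =ᵐ[μ] f' := hf.1.ae_eq_mk
  have hint : Integrable f' μ := hf.congr hae
  have hinv' : ∀ t, ∀ᵐ y ∂μ, f' (torusFlow b t y) = f' y := by
    intro t
    have hmp : MeasurePreserving (torusFlow b t) μ μ :=
      ⟨(continuous_torusFlow hb t).measurable, hmap t⟩
    filter_upwards [hinv t, hae, hmp.quasiMeasurePreserving.ae hae] with y h1 h2 h3
    rw [← h3, h1, h2]
  obtain ⟨c₁, h₁⟩ := ae_eq_const_of_unique hb hmap huniq hmeas.ennreal_ofReal
    hint.lintegral_lt_top.ne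
    (fun t => (hinv' t).mono fun y hy => by rw [hy])
  obtain ⟨c₂, h₂⟩ := ae_eq_const_of_unique hb hmap huniq hmeas.neg.ennreal_ofReal
    hint.neg.lintegral_lt_top.ne
    (fun t => (hinv' t).mono fun y hy => by simp only [Pi.neg_apply, hy])
  have hconst : ∀ᵐ y ∂μ, f y = c₁.toReal - c₂.toReal := by
    filter_upwards [h₁, h₂, hae] with y h1 h2 h3
    rw [← h1, ← h2, h3, ENNReal.toReal_ofReal', ENNReal.toReal_ofReal', Pi.neg_apply,
      max_zero_sub_eq_self]
  have hmean : ∫ y, f y ∂μ = c₁.toReal - c₂.toReal := by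
    rw [integral_congr_ae hconst]
    simp
  rwa [hmean]

end Ergodic

/-! ### The rotation sets -/

section Rotation

variable {b : Torus d → Space d}

theorem dirac_mem_invariantMeasures (hb : IsC1 b) {z : Torus d} (hz : b z = 0) :
    Measure.dirac z ∈ invariantMeasures b := by
  refine (mem_invariantMeasures_iff hb).2 ⟨inferInstance, fun t => ?_⟩
  rw [Measure.map_dirac' (continuous_torusFlow hb t).measurable, torusFlow_eq_self hb hz]

theorem convexComb_mem_invariantMeasures (hb : IsC1 b) {μ ν : Measure (Torus d)}
    (hμ : μ ∈ invariantMeasures b) (hν : ν ∈ invariantMeasures b) {s t : ℝ} (hs : 0 ≤ s)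
    (ht : 0 ≤ t) (hst : s + t = 1) :
    ENNReal.ofReal s • μ + ENNReal.ofReal t • ν ∈ invariantMeasures b := by
  rw [mem_invariantMeasures_iff hb] at hμ hν ⊢
  obtain ⟨hμ1, hμ2⟩ := hμ
  obtain ⟨hν1, hν2⟩ := hν
  refine ⟨⟨?_⟩, fun r => ?_⟩
  · simp [← ENNReal.ofReal_add hs ht, hst]
  · rw [Measure.map_add _ _ (continuous_torusFlow hb r).measurable, Measure.map_smul,
      Measure.map_smul, hμ2, hν2]

end Rotation

end TorusFlow

open TorusFlow
theorem mainTheorem4 {d : ℕ} (hd : 2 ≤ d) (ρ : Torus d → ℝ) (ξ : Space d)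
    (hρ : IsC1 ρ) (hρ_nonneg : ∀ y, 0 ≤ ρ y)
    (hzero_finite : {y | ρ y = 0}.Finite) (hzero_nonempty : {y | ρ y = 0}.Nonempty)
    (hσ : Integrable (fun y => 1 / ρ y) volume)
    (hξ : HasIncommensurableCoordinates ξ)
    (b : Torus d → Space d) (hb : b = fun y => ρ y • ξ)
    (σmean : ℝ) (hσmean : σmean = ∫ y, 1 / ρ y)
    (μ : Measure (Torus d))
    (hμ : μ = volume.withDensity fun y => ENNReal.ofReal (1 / ρ y / σmean))
    (ζ : Space d) (hζ : ζ = (1 / σmean) • ξ) :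
    0 < σmean ∧
    (μ ∈ invariantMeasures b ∧ μ {y | ρ y = 0} = 0 ∧
      ∀ ν ∈ invariantMeasures b, ν {y | ρ y = 0} = 0 → ν = μ) ∧
    IsErgodicFor b μ ∧
    acRotationSet b = {ζ} ∧
    rotationSet b = segment ℝ 0 ζ := by
  have hbC := isC1_stepanoffField hρ ξ
  have hzero : volume {y | ρ y = 0} = 0 := volume_finite_eq_zero hd hzero_finite
  change b = stepanoffField ρ ξ at hb
  subst hb
  set b := stepanoffField ρ ξ with hb
  set Z := {y | ρ y = 0} with hZ
  have hZm : MeasurableSet Z := hzero_finite.measurableSet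
  have hnn : ∀ y, 0 ≤ 1 / ρ y := fun y => one_div_nonneg.2 (hρ_nonneg y)
  have hpos : 0 < σmean := by
    rw [hσmean, integral_pos_iff_support_of_nonneg hnn hσ]
    have hsupp : Function.support (fun y => 1 / ρ y) = Zᶜ := by
      ext y
      simp [hZ]
    rw [hsupp, prob_compl_eq_one_iff hZm |>.2 hzero]
    exact one_pos
  have hηfin := isFiniteMeasure_timeMeasure hσ
  have hηuniv : timeMeasure ρ univ = ENNReal.ofReal σmean := by
    rw [timeMeasure_univ hρ_nonneg hσ, hσmean]
  have hμη : μ = ENNReal.ofReal σmean⁻¹ • timeMeasure ρ := by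
    rw [hμ, timeMeasure, ← withDensity_smul _
      (hρ.continuous.measurable.const_div 1).ennreal_ofReal]
    congr 1
    funext y
    rw [Pi.smul_apply, smul_eq_mul, ← ENNReal.ofReal_mul (by positivity), div_eq_mul_inv, mul_comm]
  have hημ : timeMeasure ρ = ENNReal.ofReal σmean • μ := by
    rw [hμη, smul_smul, ← ENNReal.ofReal_mul hpos.le, mul_inv_cancel₀ hpos.ne', ENNReal.ofReal_one,
      one_smul]
  have hμprob : IsProbabilityMeasure μ := ⟨by
    rw [hμη, Measure.smul_apply, hηuniv, smul_eq_mul, ← ENNReal.ofReal_mul (by positivity),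
      inv_mul_cancel₀ hpos.ne', ENNReal.ofReal_one]⟩
  have hμinv : μ ∈ invariantMeasures b := by
    refine (mem_invariantMeasures_iff hbC).2 ⟨hμprob, fun t => ?_⟩
    rw [hμη, Measure.map_smul, map_torusFlow_timeMeasure hρ hρ_nonneg hzero hσ]
  have hμac : μ ≪ volume := by
    rw [hμ]
    exact withDensity_absolutelyContinuous _ _
  have hμZ : μ Z = 0 := hμac hzero
  -- With `c = ν(Zᶜ)`, this is the structure of all invariant measures; `c ≤ 1` gives the segment.
  have hrestr : ∀ ν : Measure (Torus d), IsFiniteMeasure ν → (∀ t, ν.map (torusFlow b t) = ν) →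
      ∃ c : ENNReal, ν.restrict Zᶜ = c • μ ∧ ∫ y, b y ∂ν = c.toReal • ζ := by
    intro ν hνfin hν
    obtain ⟨c, hc⟩ := restrict_eq_smul_timeMeasure hρ hρ_nonneg hξ ν hν
    refine ⟨c * ENNReal.ofReal σmean, ?_, ?_⟩
    · rw [hc, hημ, smul_smul]
    · rw [integral_stepanoffField_eq hρ hρ_nonneg hzero hc, hζ, smul_smul, ENNReal.toReal_mul,
        ENNReal.toReal_ofReal hpos.le, mul_assoc, mul_one_div_cancel hpos.ne', mul_one]
  have huniq : ∀ ν : Measure (Torus d), IsFiniteMeasure ν → (∀ t, ν.map (torusFlow b t) = ν) →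
      ν Z = 0 → ∃ c : ENNReal, ν = c • μ := by
    intro ν hνfin hν hνZ
    obtain ⟨c, hc, -⟩ := hrestr ν hνfin hν
    refine ⟨c, ?_⟩
    rw [← hc, Measure.restrict_eq_self_of_ae_mem]
    exact measure_eq_zero_iff_ae_notMem.1 hνZ
  have huniq' : ∀ ν ∈ invariantMeasures b, ν Z = 0 → ν = μ := by
    intro ν hν hνZ
    obtain ⟨hνprob, hνmap⟩ := (mem_invariantMeasures_iff hbC).1 hν
    obtain ⟨c, rfl⟩ := huniq ν inferInstance hνmap hνZ
    have h1 : (c • μ) univ = 1 := measure_univ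
    rw [Measure.smul_apply, measure_univ, smul_eq_mul, mul_one] at h1
    rw [h1, one_smul]
  have hμb : ∫ y, b y ∂μ = ζ := by
    rw [hμη, integral_smul_measure, integral_stepanoffField_timeMeasure hρ hρ_nonneg hzero, hζ,
      ENNReal.toReal_ofReal (by positivity), one_div]
  refine ⟨hpos, ⟨hμinv, hμZ, huniq'⟩, ?_, ?_, ?_⟩
  · exact isErgodicFor_of_unique hbC hμinv fun ν hνfin hν hνμ => huniq ν hνfin hν (hνμ hμZ)
  · have hint : ∀ σ : Torus d → ℝ, AEMeasurable σ → (∀ᵐ y, 0 ≤ σ y) →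
        ∫ y, σ y • b y = ∫ y, b y ∂volume.withDensity fun y => ENNReal.ofReal (σ y) := by
      intro σ hσm hσ0
      rw [integral_withDensity_eq_integral_toReal_smul₀ hσm.ennreal_ofReal
        (.of_forall fun y => ENNReal.ofReal_lt_top)]
      refine integral_congr_ae ?_
      filter_upwards [hσ0] with y hy
      rw [ENNReal.toReal_ofReal hy]
    refine Subset.antisymm ?_ ?_
    · rintro z ⟨σ, hσi, hσ0, hσinv, rfl⟩
      rw [mem_singleton_iff, hint σ hσi.aemeasurable hσ0,
        huniq' _ hσinv (withDensity_absolutelyContinuous _ _ hzero), hμb]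
    · rintro z rfl
      refine ⟨fun y => 1 / ρ y / σmean, hσ.div_const σmean,
        .of_forall fun y => div_nonneg (hnn y) hpos.le, hμ ▸ hμinv, ?_⟩
      rw [hint _ (hσ.div_const σmean).aemeasurable
        (.of_forall fun y => div_nonneg (hnn y) hpos.le), ← hμ, hμb]
  · rw [segment_eq_image]
    refine Subset.antisymm ?_ ?_
    · rintro z ⟨ν, hν, rfl⟩
      obtain ⟨hνprob, hνmap⟩ := (mem_invariantMeasures_iff hbC).1 hν
      obtain ⟨c, hc, hcb⟩ := hrestr ν inferInstance hνmap
      have hc1 : c ≤ 1 := by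
        have h1 : ν.restrict Zᶜ univ = (c • μ) univ := by rw [hc]
        rw [Measure.smul_apply, measure_univ (μ := μ), smul_eq_mul, mul_one,
          Measure.restrict_apply_univ] at h1
        exact h1 ▸ prob_le_one
      refine ⟨c.toReal, ⟨ENNReal.toReal_nonneg, ?_⟩, ?_⟩
      · exact ENNReal.toReal_le_of_le_ofReal zero_le_one (by simpa using hc1)
      · simp [hcb]
    · rintro z ⟨θ, ⟨hθ0, hθ1⟩, rfl⟩
      -- The points of the segment are reached by mixing `μ` with the mass at a zero of `ρ`.
      obtain ⟨z, hz⟩ := hzero_nonempty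
      have hbz : b z = 0 := by
        rw [hb, stepanoffField, show ρ z = 0 from hz, zero_smul]
      refine ⟨_, convexComb_mem_invariantMeasures hbC (dirac_mem_invariantMeasures hbC hbz) hμinv
        (sub_nonneg.2 hθ1) hθ0 (sub_add_cancel 1 θ), ?_⟩
      rw [integral_add_measure
        ((integrable_of_continuous _ hbC.continuous).smul_measure ENNReal.ofReal_ne_top)
        ((integrable_of_continuous _ hbC.continuous).smul_measure ENNReal.ofReal_ne_top),
        integral_smul_measure, integral_smul_measure, hμb, integral_dirac, hbz,
        ENNReal.toReal_ofReal (sub_nonneg.2 hθ1), ENNReal.toReal_ofReal hθ0]
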